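/- **Conventions.** Let $\Delta$ be a flag simplicial complex on $[n]$ (a non-empty family of subsets of $[n]$ closed under taking subsets, containing every $\{i\}$, and containing every $F$ with $|F|>2$ all of whose two-element subsets belong to $\Delta$). Write $j\sim i$ if $\{i,j\}\in\Delta$, and let $\dim\Delta$ be the size of a largest face minus one. A *binary geometry* for $\Delta$ is an affine algebraic variety $\tilde U\subset\mathbb C^n$ with $\dim\tilde U=\dim\Delta+1$ that is the common zero set of equations $$u_i+\prod_{j\,:\,j\not\sim i}u_j^{a_{ij}}-1=0,\qquad i=1,\dots,n,$$ for some integers $a_{ij}>0$, such that for every $S\subset[n]$ the set $\tilde U_S=\tilde U\cap\{u_s=0 \text{ for all } s\in S\}$ is non-empty if and only if $S\in\Delta$, and in this case $\tilde U_S$ is irreducible of codimension $|S|$ in $\tilde U$. **Theorem.** 1. If $\tilde U$ is a one-dimensional binary geometry for $\Delta$, then $n=2$, $\Delta=\{\emptyset,\{1\},\{2\}\}$ consists of exactly two isolated vertices, and $\tilde U\cong\mathbb C$ as an affine variety. 2. Let $\Delta=\{\emptyset,\{1\},\{2\}\}$ and let $a,b$ be positive integers. The solution set in $\mathbb C^2$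 of $u_1+u_2^a=1$, $u_2+u_1^b=1$ is a binary geometry for $\Delta$ (with these equations) if and only if $a=b=1$. 3. Let $n\ge 3$, let $\Delta=\{\emptyset,\{1\},\dots,\{n\}\}$ consist of $n$ isolated vertices, and let $a_{ij}$ ($i\ne j$) be arbitrary positive integers. Then the point $(0,1,\dots,1)$, and likewise every point with one coordinate equal to $0$ and all others equal to $1$, is an isolated point, in the Zariski topology, of the set of solutions in $\mathbb C^n$ of $u_i+\prod_{j\ne i}u_j^{a_{ij}}=1$, $i=1,\dots,n$. -/

import Mathlib

/-- A simplicial complex on the vertex labels `Fin n`: a non-empty, downward closed family of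
finite sets. The empty set is a face; a label need not be a vertex. -/
structure FaceComplex (n : ℕ) where
  faces : Finset (Finset (Fin n))
  down_closed : ∀ F ∈ faces, ∀ G, G ⊆ F → G ∈ faces
  nonempty : faces.Nonempty

namespace FaceComplex

/-- The dimension: the size of a largest face, minus one (so `{∅}` has dimension `-1`). -/
def dim {n : ℕ} (Δ : FaceComplex n) : ℤ := ((Δ.faces.sup Finset.card : ℕ) : ℤ) - 1

/-- `i ∼ j`: the set `{i, j}` is a face. -/
def Compatible {n : ℕ} (Δ : FaceComplex n) (i j : Fin n) : Prop := {i, j} ∈ Δ.faces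

instance {n : ℕ} (Δ : FaceComplex n) (i j : Fin n) : Decidable (Δ.Compatible i j) :=
  inferInstanceAs (Decidable ({i, j} ∈ Δ.faces))

/-- Flag complexes: every label is a vertex, and a set with more than two elements is a face as
soon as all its pairs are. -/
def IsFlag {n : ℕ} (Δ : FaceComplex n) : Prop :=
  (∀ i, {i} ∈ Δ.faces) ∧
    ∀ F : Finset (Fin n), 2 < F.card → (∀ i ∈ F, ∀ j ∈ F, i ≠ j → Δ.Compatible i j) → F ∈ Δ.faces

/-- The complex consists of isolated vertices: its faces are the empty set and all singletons. -/
def IsIsolatedVertices {n : ℕ} (Δ : FaceComplex n) : Prop :=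
  ∀ F : Finset (Fin n), F ∈ Δ.faces ↔ F.card ≤ 1

end FaceComplex

/-- Complex affine space `ℂⁿ`: a copy of `Fin n → ℂ`, to carry the Zariski topology. -/
@[ext]
structure CAffine (n : ℕ) where
  coord : Fin n → ℂ

/-- The common zero set of a set of polynomials. -/
def polyZeros {n : ℕ} (P : Set (MvPolynomial (Fin n) ℂ)) : Set (CAffine n) :=
  {x | ∀ p ∈ P, MvPolynomial.eval x.coord p = 0}

/-- The Zariski topology: the closed sets are the zero sets of sets of polynomials. -/
instance {n : ℕ} : TopologicalSpace (CAffine n) :=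
  TopologicalSpace.ofClosed {Z | ∃ P : Set (MvPolynomial (Fin n) ℂ), Z = polyZeros P}
    ⟨{1}, by apply Set.ext; simp [polyZeros]⟩
    (by
      intro A hA
      refine ⟨⋃₀ {P | polyZeros P ∈ A}, ?_⟩
      apply Set.ext; intro x
      simp only [Set.mem_sInter, polyZeros, Set.mem_ofPred_eq, Set.mem_sUnion]
      constructor
      · rintro h p ⟨P, hP, hp⟩
        exact h _ hP p hp
      · intro h Z hZ
        obtain ⟨P, rfl⟩ := hA hZ
        exact fun p hp => h p ⟨P, hZ, hp⟩)
    (by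
      rintro _ ⟨P, rfl⟩ _ ⟨Q, rfl⟩
      refine ⟨{r | ∃ p ∈ P, ∃ q ∈ Q, r = p * q}, ?_⟩
      apply Set.ext; intro x
      simp only [polyZeros, Set.mem_union, Set.mem_ofPred_eq]
      constructor
      · rintro (h | h) r ⟨p, hp, q, hq, rfl⟩
        · simp [h p hp]
        · simp [h q hq]
      · intro h
        by_contra! hc
        obtain ⟨⟨p, hp, hp0⟩, ⟨q, hq, hq0⟩⟩ := hc
        have := h _ ⟨p, hp, q, hq, rfl⟩
        simp [hp0, hq0] at this)

theorem CAffine.isClosed_iff {n : ℕ} (Z : Set (CAffine n)) :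
    IsClosed Z ↔ ∃ P : Set (MvPolynomial (Fin n) ℂ), Z = polyZeros P := by
  rw [← isOpen_compl_iff]
  change Zᶜᶜ ∈ {Z | ∃ P : Set (MvPolynomial (Fin n) ℂ), Z = polyZeros P} ↔ _
  rw [compl_compl]
  rfl

/-- The dimension of a subset of affine space: the Krull dimension of its Zariski topology. -/
noncomputable def zariskiDim {n : ℕ} (V : Set (CAffine n)) : WithBot ℕ∞ := topologicalKrullDim V

/-- The polynomial map `ℂⁿ → ℂᵐ` with components `f`. -/
noncomputable def polyMap {n m : ℕ} (f : Fin m → MvPolynomial (Fin n) ℂ) (x : CAffine n) :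
    CAffine m := ⟨fun k => MvPolynomial.eval x.coord (f k)⟩

/-- Isomorphism of affine varieties given as subsets of affine spaces: mutually inverse
polynomial maps. -/
def PolyIsomorphic {n m : ℕ} (V : Set (CAffine n)) (W : Set (CAffine m)) : Prop :=
  ∃ (f : Fin m → MvPolynomial (Fin n) ℂ) (g : Fin n → MvPolynomial (Fin m) ℂ),
    Set.MapsTo (polyMap f) V W ∧ Set.MapsTo (polyMap g) W V ∧
      Set.LeftInvOn (polyMap g) (polyMap f) V ∧ Set.RightInvOn (polyMap g) (polyMap f) W

/-- The solution set in `ℂⁿ` of the equations `u i + ∏ (j ≁ i), u j ^ a i j - 1 = 0`. -/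
def uVariety {n : ℕ} (Δ : FaceComplex n) (a : Fin n → Fin n → ℕ) : Set (CAffine n) :=
  {u | ∀ i, u.coord i +
    ∏ j ∈ Finset.univ.filter (fun j => ¬ Δ.Compatible j i), u.coord j ^ a i j - 1 = 0}

/-- The coordinate subspace where the coordinates labelled by `S` vanish. -/
def coordSubspace {n : ℕ} (S : Finset (Fin n)) : Set (CAffine n) := {u | ∀ s ∈ S, u.coord s = 0}

/-- `V` is a binary geometry for the flag complex `Δ`, cut out (as a set) by the `u`-equations
with exponents `a`. Only the values `a i j` at incompatible pairs matter. -/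
structure IsBinaryGeometryWith {n : ℕ} (Δ : FaceComplex n) (a : Fin n → Fin n → ℕ)
    (V : Set (CAffine n)) : Prop where
  flag : Δ.IsFlag
  exponent_pos : ∀ i j, ¬ Δ.Compatible i j → 0 < a i j
  cut_out : V = uVariety Δ a
  dim_eq : ∃ d : ℕ, zariskiDim V = d ∧ (d : ℤ) = Δ.dim + 1
  nonempty_iff : ∀ S : Finset (Fin n), (V ∩ coordSubspace S).Nonempty ↔ S ∈ Δ.faces
  irreducible : ∀ S ∈ Δ.faces, IsIrreducible (V ∩ coordSubspace S)
  /-- Codimension `|S|`; as the stratum is irreducible, purity needs no separate clause. -/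
  codim_eq : ∀ S ∈ Δ.faces, zariskiDim (V ∩ coordSubspace S) + (S.card : ℕ∞) = zariskiDim V

/-- `V` is a binary geometry for `Δ`. -/
def IsBinaryGeometry {n : ℕ} (Δ : FaceComplex n) (V : Set (CAffine n)) : Prop :=
  ∃ a : Fin n → Fin n → ℕ, IsBinaryGeometryWith Δ a V

/-! The heart is part 3. Put `t = u i₀`; near the point in question `t` is small and every other `u
j` is `1 - t ^ a j i₀` up to higher order. Expanding equation `i₀` in powers of `t`, the first
coefficient that does not cancel is a nonzero integer `d`, at some order `m`. Thus `d * t ^ m`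
vanishes modulo the equations and `t ^ (m + 1)` (`exists_torsion_relation`), so `(d - r * t) * t ^
m` vanishes on the solution set for some polynomial `r`. Where `d - r * t ≠ 0`, an open set
containing the point, this forces `t = 0`, hence all other coordinates equal 1.

For part 1, dimension one makes the flag complex a set of isolated vertices. An irreducible T1 space
with an isolated point is a single point, of dimension 0, so `n ≥ 3` is impossible; `n < 2` also
gives only one point. For `n = 2`, eliminating a variable leaves one polynomial in the other, so the
solution set is finite with at least two points, hence reducible, unless both exponents are 1, when
it is a line. This also gives part 2. -/

/-! ### Expansion of the equations in powers of a nilpotent coordinate -/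

theorem prod_pow_mul_eq_self {ι Q : Type*} [CommRing Q] (s : Finset ι) (x : ι → Q) (b : ι → ℕ)
    (z : Q) (h : ∀ j ∈ s, x j * z = z) : (∏ j ∈ s, x j ^ b j) * z = z := by
  classical
  have hp : ∀ (y : Q) (k : ℕ), y * z = z → y ^ k * z = z := by
    intro y k hy
    induction k with
    | zero => simp
    | succ k ih => rw [pow_succ, mul_assoc, hy, ih]
  induction s using Finset.induction_on with
  | empty => simp
  | insert i s hi ih =>
    rw [Finset.prod_insert hi, mul_assoc, ih fun j hj => h j (Finset.mem_insert_of_mem hj),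
      hp _ _ (h i (Finset.mem_insert_self i s))]

/-- Since `z * z = 0`, only the linear terms of the factors survive, and they add up. -/
theorem prod_one_sub_pow {ι Q : Type*} [CommRing Q] (s : Finset ι) (x : ι → Q) (b y : ι → ℕ)
    (z : Q) (hz : z * z = 0) (h : ∀ j ∈ s, x j = 1 - y j * z) :
    ∏ j ∈ s, x j ^ b j = 1 - ((∑ j ∈ s, b j * y j : ℕ) : Q) * z := by
  classical
  have hp : ∀ (c k : ℕ), (1 - (c : Q) * z) ^ k = 1 - ((k * c : ℕ) : Q) * z := by
    intro c k
    induction k with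
    | zero => simp
    | succ k ih =>
      rw [pow_succ, ih]
      push_cast
      linear_combination (k * c * c : Q) * hz
  induction s using Finset.induction_on with
  | empty => simp
  | insert i s hi ih =>
    rw [Finset.prod_insert hi, Finset.sum_insert hi,
      ih fun j hj => h j (Finset.mem_insert_of_mem hj), h i (Finset.mem_insert_self i s), hp]
    push_cast
    linear_combination ((b i * y i : Q) * (∑ j ∈ s, (b j : Q) * y j)) * hz

/-- Solutions of the `u`-equations of isolated vertices over a ring in which a power of the
coordinate `u i₀` vanishes satisfy an integral torsion relation for the preceding power. -/
theorem exists_torsion_relation {ι : Type*} [Fintype ι] [DecidableEq ι] (a : ι → ι → ℕ)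
    (ha : ∀ i j, i ≠ j → 0 < a i j) (hcard : 3 ≤ Fintype.card ι) (i₀ : ι) :
    ∃ (m : ℕ) (d : ℤ), d ≠ 0 ∧ ∀ (Q : Type) [CommRing Q] (u : ι → Q),
      (∀ i, u i + ∏ j ∈ Finset.univ.erase i, u j ^ a i j = 1) → u i₀ ^ (m + 1) = 0 →
        (d : Q) * u i₀ ^ m = 0 := by
  have key : ∀ (Q : Type) [CommRing Q] (u : ι → Q),
      (∀ i, u i + ∏ j ∈ Finset.univ.erase i, u j ^ a i j = 1) → ∀ j, j ≠ i₀ →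
      u j = 1 - u i₀ ^ a j i₀ * ∏ k ∈ (Finset.univ.erase j).erase i₀, u k ^ a j k := by
    intro Q _ u hu j hj
    rw [Finset.mul_prod_erase _ (fun k => u k ^ a j k) (by simp [hj.symm])]
    exact eq_sub_of_add_eq (hu j)
  -- Modulo `u i₀ ^ 2`, equation `i₀` reads `u i₀ + (1 - C * u i₀) = 1`, so order one decides the
  -- matter unless `C = 1`.
  set C : ℕ := ∑ j ∈ Finset.univ.erase i₀, a i₀ j * (if a j i₀ = 1 then 1 else 0) with hC
  by_cases hC1 : C = 1
  -- A sum of naturals equal to 1 has exactly one nonzero term: one `j₀` has both exponents shared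
  -- with `i₀` equal to 1, and every other `a j i₀` is at least 2.
  · obtain ⟨j₀, hj₀, hne⟩ : ∃ j ∈ Finset.univ.erase i₀, a i₀ j * (if a j i₀ = 1 then 1 else 0) ≠ 0 := by
      by_contra! h
      rw [hC, Finset.sum_eq_zero h] at hC1
      exact zero_ne_one hC1
    have hji : j₀ ≠ i₀ := Finset.ne_of_mem_erase hj₀
    have he₀ : a j₀ i₀ = 1 := by
      by_contra h
      simp [h] at hne
    rw [hC, ← Finset.add_sum_erase _ _ hj₀] at hC1
    simp only [he₀, if_true, mul_one] at hC1
    have hb := ha i₀ j₀ hji.symm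
    have hb₀ : a i₀ j₀ = 1 := by omega
    have hrest : ∑ j ∈ (Finset.univ.erase i₀).erase j₀,
        a i₀ j * (if a j i₀ = 1 then 1 else 0) = 0 := by omega
    rw [Finset.sum_eq_zero_iff] at hrest
    set s := (Finset.univ.erase i₀).erase j₀ with hs
    have hsne : s.Nonempty := by
      rw [← Finset.card_pos, hs, Finset.card_erase_of_mem hj₀,
        Finset.card_erase_of_mem (Finset.mem_univ _), Finset.card_univ]
      omega
    -- The next order that can contribute is the least exponent among the remaining vertices, which
    -- exist because there are at least three vertices.
    obtain ⟨j₁, hj₁, hmin⟩ := s.exists_min_image (fun j => a j i₀) hsne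
    have hmem : ∀ j, j ∈ s ↔ j ≠ j₀ ∧ j ≠ i₀ := by simp [hs]
    have htwo : ∀ j ∈ s, 2 ≤ a j i₀ := by
      intro j hj
      have h1 := ha j i₀ ((hmem j).1 hj).2
      have h2 := ha i₀ j ((hmem j).1 hj).2.symm
      have h3 := hrest j hj
      by_contra h
      have h4 : a j i₀ = 1 := by omega
      simp [h4] at h3
      omega
    set m := a j₁ i₀ with hm
    have hm2 : 2 ≤ m := htwo j₁ hj₁
    refine ⟨m, ((∑ j ∈ s, a i₀ j * (if a j i₀ = m then 1 else 0) : ℕ) : ℤ), ?_, ?_⟩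
    · rw [Nat.cast_ne_zero]
      have h1 := Finset.single_le_sum (f := fun j => a i₀ j * (if a j i₀ = m then 1 else 0))
        (fun _ _ => Nat.zero_le _) hj₁
      have h2 := ha i₀ j₁ ((hmem j₁).1 hj₁).2.symm
      simp only [← hm, if_true, mul_one] at h1
      omega
    · intro Q _ u hu ht
      have hk := key Q u hu
      have hpow : ∀ k, m + 1 ≤ k → u i₀ ^ k = 0 := fun k hk => pow_eq_zero_of_le hk ht
      have hut : ∀ j ∈ s, u j * u i₀ = u i₀ := by
        intro j hj
        have h1 : u i₀ ^ (a j i₀ + 1) = 0 := hpow _ (by have := hmin j hj; omega)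
        conv_lhs => rw [hk j ((hmem j).1 hj).2]
        linear_combination (-∏ k ∈ (Finset.univ.erase j).erase i₀, u k ^ a j k) * h1
      -- This is exact: the remaining factors differ from 1 by multiples of `u i₀ ^ m`, which `u i₀`
      -- kills.
      have hu₀ : u j₀ = 1 - u i₀ := by
        have h := hk j₀ hji
        rw [he₀, pow_one, Finset.erase_right_comm, ← hs, mul_comm,
          prod_pow_mul_eq_self s u (a j₀) _ hut] at h
        exact h
      have hum : ∀ j, j ≠ i₀ → u j * u i₀ ^ m = u i₀ ^ m := by
        intro j hj
        have h1 : u i₀ ^ (a j i₀ + m) = 0 := hpow _ (by have := ha j i₀ hj; omega)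
        conv_lhs => rw [hk j hj]
        rw [pow_add] at h1
        linear_combination (-∏ k ∈ (Finset.univ.erase j).erase i₀, u k ^ a j k) * h1
      have hform : ∀ j ∈ s, u j = 1 - ((if a j i₀ = m then 1 else 0 : ℕ) : Q) * u i₀ ^ m := by
        intro j hj
        have h1 := hk j ((hmem j).1 hj).2
        split_ifs with h
        · rw [h, mul_comm, prod_pow_mul_eq_self _ u (a j) _
            fun k hk => hum k (Finset.ne_of_mem_erase hk)] at h1
          simpa using h1
        · have h2 := hmin j hj
          rw [hpow (a j i₀) (by omega)] at h1
          simpa using h1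
      have hzz : u i₀ ^ m * u i₀ ^ m = 0 := by rw [← pow_add]; exact hpow _ (by omega)
      -- With `D` the integer chosen above, the equation is `u i₀ + (1 - u i₀) * (1 - D * u i₀ ^ m)
      -- = 1`; the linear terms cancel and `D * u i₀ ^ m` remains.
      have h0 := hu i₀
      rw [← Finset.mul_prod_erase _ _ hj₀, ← hs, hb₀, pow_one, hu₀,
        prod_one_sub_pow s u (a i₀) _ _ hzz hform] at h0
      rw [Int.cast_natCast]
      rw [pow_succ] at ht
      linear_combination ((∑ j ∈ s, a i₀ j * (if a j i₀ = m then 1 else 0) : ℕ) : Q) * ht - h0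
  · refine ⟨1, 1 - C, sub_ne_zero.2 (by exact_mod_cast Ne.symm hC1), ?_⟩
    intro Q _ u hu ht
    have hk := key Q u hu
    have hpow : ∀ k, 2 ≤ k → u i₀ ^ k = 0 := fun k hk => pow_eq_zero_of_le hk ht
    have hut : ∀ j, j ≠ i₀ → u j * u i₀ = u i₀ := by
      intro j hj
      have h1 : u i₀ ^ (a j i₀ + 1) = 0 := hpow _ (by have := ha j i₀ hj; omega)
      conv_lhs => rw [hk j hj]
      linear_combination (-∏ k ∈ (Finset.univ.erase j).erase i₀, u k ^ a j k) * h1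
    have hform : ∀ j ∈ Finset.univ.erase i₀,
        u j = 1 - ((if a j i₀ = 1 then 1 else 0 : ℕ) : Q) * u i₀ := by
      intro j hj
      have hji := Finset.ne_of_mem_erase hj
      have h1 := hk j hji
      split_ifs with h
      · rw [h, pow_one, mul_comm, prod_pow_mul_eq_self _ u (a j) _
          fun k hk => hut k (Finset.ne_of_mem_erase hk)] at h1
        simpa using h1
      · have h2 := ha j i₀ hji
        rw [hpow (a j i₀) (by omega)] at h1
        simpa using h1
    have h0 := hu i₀
    rw [prod_one_sub_pow _ u (a i₀) _ _ (by rw [← sq]; exact ht) hform, ← hC] at h0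
    push_cast
    linear_combination h0

/-! ### Flag complexes of dimension zero -/

namespace FaceComplex

theorem IsIsolatedVertices.compatible_iff {n : ℕ} {Δ : FaceComplex n} (h : Δ.IsIsolatedVertices)
    (i j : Fin n) : Δ.Compatible i j ↔ i = j := by
  rw [Compatible, h]
  constructor
  · intro hc
    exact Finset.card_le_one.1 hc i (by simp) j (by simp)
  · rintro rfl
    simp

theorem IsIsolatedVertices.isFlag {n : ℕ} {Δ : FaceComplex n} (h : Δ.IsIsolatedVertices) :
    Δ.IsFlag := by
  refine ⟨fun i => (h _).2 (by simp), fun F hF hc => ?_⟩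
  obtain ⟨i, hi, j, hj, hij⟩ := Finset.one_lt_card.1 (show 1 < F.card by omega)
  exact absurd ((h.compatible_iff i j).1 (hc i hi j hj hij)) hij

theorem IsFlag.isIsolatedVertices {n : ℕ} {Δ : FaceComplex n} (h : Δ.IsFlag)
    (hd : Δ.dim = 0) : Δ.IsIsolatedVertices := by
  have hd' : Δ.faces.sup Finset.card = 1 := by
    unfold dim at hd
    omega
  intro F
  refine ⟨fun hF => hd' ▸ Finset.le_sup (f := Finset.card) hF, fun hF => ?_⟩
  obtain ⟨G, hG⟩ := Δ.nonempty
  rcases F.eq_empty_or_nonempty with rfl | ⟨i, hi⟩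
  · exact Δ.down_closed G hG _ (Finset.empty_subset G)
  · have : F = {i} := by
      ext j
      rw [Finset.mem_singleton]
      exact ⟨fun hj => Finset.card_le_one.1 hF j hj i hi, fun hj => hj ▸ hi⟩
    exact this ▸ h.1 i

theorem IsIsolatedVertices.dim_eq_zero {n : ℕ} {Δ : FaceComplex n} (h : Δ.IsIsolatedVertices)
    (i : Fin n) : Δ.dim = 0 := by
  have h1 : Δ.faces.sup Finset.card ≤ 1 := Finset.sup_le fun F hF => (h F).1 hF
  have h2 : 1 ≤ Δ.faces.sup Finset.card :=
    Finset.le_sup (f := Finset.card) ((h {i}).2 (by simp))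
  unfold dim
  omega

end FaceComplex

/-! ### Isolated points of the solution set -/

theorem mem_uVariety_iff {n : ℕ} {Δ : FaceComplex n} (h : Δ.IsIsolatedVertices)
    (a : Fin n → Fin n → ℕ) (u : CAffine n) :
    u ∈ uVariety Δ a ↔
      ∀ i, u.coord i + ∏ j ∈ Finset.univ.erase i, u.coord j ^ a i j = 1 := by
  have hf : ∀ i, Finset.univ.filter (fun j => ¬ Δ.Compatible j i) = Finset.univ.erase i := by
    intro i
    ext j
    simp [h.compatible_iff]
  simp only [uVariety, Set.mem_ofPred_eq, hf, sub_eq_zero]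

theorem CAffine.isOpen_ne_zero {n : ℕ} (p : MvPolynomial (Fin n) ℂ) :
    IsOpen {x : CAffine n | MvPolynomial.eval x.coord p ≠ 0} := by
  rw [← isClosed_compl_iff, CAffine.isClosed_iff]
  refine ⟨{p}, ?_⟩
  ext x
  simp [polyZeros]

instance {n : ℕ} : T1Space (CAffine n) := by
  refine ⟨fun x => (CAffine.isClosed_iff _).2
    ⟨Set.range fun i => MvPolynomial.X i - MvPolynomial.C (x.coord i), ?_⟩⟩
  ext y
  simp [polyZeros, CAffine.ext_iff, funext_iff, sub_eq_zero]

theorem uVariety_inter_open_eq_singleton {n : ℕ} {Δ : FaceComplex n} {a : Fin n → Fin n → ℕ}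
    (hn : 3 ≤ n) (hΔ : Δ.IsIsolatedVertices) (ha : ∀ i j, i ≠ j → 0 < a i j) (i : Fin n) :
    ∃ O : Set (CAffine n), IsOpen O ∧
      uVariety Δ a ∩ O = {CAffine.mk fun j => if j = i then 0 else 1} := by
  obtain ⟨m, d, hd, H⟩ := exists_torsion_relation a ha (by simpa using hn) i
  let eqn : Fin n → MvPolynomial (Fin n) ℂ := fun k =>
    MvPolynomial.X k + ∏ j ∈ Finset.univ.erase k, MvPolynomial.X j ^ a k j - 1
  let I : Ideal (MvPolynomial (Fin n) ℂ) :=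
    Ideal.span (insert (MvPolynomial.X i ^ (m + 1)) (Set.range eqn))
  -- The relation is applied to the universal solution, the quotient by the equations and `X i ^ (m
  -- + 1)`, and then lifted to polynomials.
  have hrel := H (MvPolynomial (Fin n) ℂ ⧸ I) (fun j => Ideal.Quotient.mk I (MvPolynomial.X j))
    (fun k => by
      have h : Ideal.Quotient.mk I (eqn k) = 0 := Ideal.Quotient.eq_zero_iff_mem.2
        (Ideal.subset_span (Set.mem_insert_of_mem _ ⟨k, rfl⟩))
      simpa [eqn, sub_eq_zero] using h)
    (by
      rw [← map_pow]
      exact Ideal.Quotient.eq_zero_iff_mem.2 (Ideal.subset_span (Set.mem_insert _ _)))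
  rw [← map_pow, ← map_intCast (Ideal.Quotient.mk I), ← map_mul, Ideal.Quotient.eq_zero_iff_mem,
    Ideal.mem_span_insert] at hrel
  obtain ⟨r, z, hz, hrz⟩ := hrel
  refine ⟨_, CAffine.isOpen_ne_zero ((d : MvPolynomial (Fin n) ℂ) - r * MvPolynomial.X i), ?_⟩
  ext u
  simp only [Set.mem_inter_iff, mem_uVariety_iff hΔ, Set.mem_singleton_iff, Set.mem_ofPred_eq]
  constructor
  · rintro ⟨hu, hs⟩
    have hz0 : MvPolynomial.eval u.coord z = 0 := by
      have hle : Ideal.span (Set.range eqn) ≤ RingHom.ker (MvPolynomial.eval u.coord) := by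
        rw [Ideal.span_le]
        rintro _ ⟨k, rfl⟩
        simpa [eqn, RingHom.mem_ker, sub_eq_zero] using hu k
      exact hle hz
    have h1 := congrArg (MvPolynomial.eval u.coord) hrz
    simp only [map_mul, map_pow, map_add, map_intCast, MvPolynomial.eval_X, hz0] at h1
    simp only [map_sub, map_mul, map_intCast, MvPolynomial.eval_X] at hs
    have h2 : (d - MvPolynomial.eval u.coord r * u.coord i) * u.coord i ^ m = 0 := by
      linear_combination h1
    have h3 : u.coord i = 0 := eq_zero_of_pow_eq_zero ((mul_eq_zero.1 h2).resolve_left hs)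
    ext j
    by_cases hj : j = i
    · simp [hj, h3]
    · have h4 := hu j
      rw [Finset.prod_eq_zero (i := i) (by simp [Ne.symm hj])
        (by rw [h3, zero_pow (ha j i hj).ne'])] at h4
      simpa [hj] using h4
  · rintro rfl
    -- At the point `X i` is 0, so the polynomial defining the open set takes the value `d ≠ 0`.
    refine ⟨fun k => ?_, by simpa using hd⟩
    by_cases hk : k = i
    · subst hk
      rw [Finset.prod_eq_one fun j hj => by simp [Finset.ne_of_mem_erase hj]]
      simp
    · rw [Finset.prod_eq_zero (i := i) (by simp [Ne.symm hk])
        (by simp [(ha k i hk).ne'])]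
      simp [hk]

/-! ### Irreducibility and dimension in T1 spaces -/

/-- Otherwise `O` and the complement of `p` would be open sets that both meet `V` but have no common
point in it. -/
theorem IsIrreducible.subset_singleton_of_inter_open {X : Type*} [TopologicalSpace X] [T1Space X]
    {V O : Set X} {p : X} (hV : IsIrreducible V) (hO : IsOpen O) (h : V ∩ O = {p}) : V = {p} := by
  have hp : p ∈ V ∩ O := h ▸ Set.mem_singleton p
  refine Set.Subset.antisymm (fun q hq => ?_) (Set.singleton_subset_iff.2 hp.1)
  by_contra hqp
  obtain ⟨x, hxV, hxO, hx⟩ := hV.isPreirreducible O {p}ᶜ hO isOpen_compl_singleton ⟨p, hp⟩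
    ⟨q, hq, hqp⟩
  exact hx (h ▸ ⟨hxV, hxO⟩)

theorem IsIrreducible.eq_singleton_of_finite {X : Type*} [TopologicalSpace X] [T1Space X]
    {V : Set X} {p : X} (hV : IsIrreducible V) (hf : V.Finite) (hp : p ∈ V) : V = {p} := by
  refine hV.subset_singleton_of_inter_open (O := (V \ {p})ᶜ)
    (hf.subset Set.sdiff_subset).isClosed.isOpen_compl ?_
  ext x
  simp only [Set.mem_inter_iff, Set.mem_compl_iff, Set.mem_sdiff, Set.mem_singleton_iff, not_and,
    not_not]
  exact ⟨fun h => h.2 h.1, by rintro rfl; exact ⟨hp, fun _ => rfl⟩⟩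

theorem zariskiDim_singleton {n : ℕ} (p : CAffine n) : zariskiDim {p} = 0 := by
  unfold zariskiDim
  refine le_antisymm (topologicalKrullDim_zero_of_discreteTopology ({p} : Set (CAffine n))) ?_
  have : Nonempty (TopologicalSpace.IrreducibleCloseds ({p} : Set (CAffine n))) :=
    ⟨⟨{⟨p, rfl⟩}, isIrreducible_singleton, isClosed_singleton⟩⟩
  exact Order.krullDim_nonneg

theorem isIrreducible_of_infinite {X : Type*} [TopologicalSpace X] {V : Set X} (hV : V.Infinite)
    (h : ∀ Z, IsClosed Z → V ⊆ Z ∨ (V ∩ Z).Finite) : IsIrreducible V := by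
  refine ⟨hV.nonempty, fun U W hU hW ⟨x, hxV, hxU⟩ ⟨y, hyV, hyW⟩ => ?_⟩
  have h1 := (h Uᶜ hU.isClosed_compl).resolve_left fun hc => hc hxV hxU
  have h2 := (h Wᶜ hW.isClosed_compl).resolve_left fun hc => hc hyV hyW
  obtain ⟨z, hz, hzn⟩ := (hV.sdiff (h1.union h2)).nonempty
  refine ⟨z, hz, ?_⟩
  by_contra hc
  apply hzn
  by_cases hzU : z ∈ U
  · exact Or.inr ⟨hz, fun hzW => hc ⟨hzU, hzW⟩⟩
  · exact Or.inl ⟨hz, hzU⟩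

theorem topologicalKrullDim_eq_one {X : Type*} [TopologicalSpace X] [T1Space X] [Infinite X]
    (h : ∀ Z : Set X, IsClosed Z → Z = Set.univ ∨ Z.Finite) : topologicalKrullDim X = 1 := by
  have huniv : IsIrreducible (Set.univ : Set X) :=
    isIrreducible_of_infinite Set.infinite_univ fun Z hZ => by
      rcases h Z hZ with h | h
      · exact Or.inl h.ge
      · exact Or.inr (h.subset Set.inter_subset_right)
  apply le_antisymm
  · refine Order.krullDim_le_one_iff.2 fun Z => ?_
    rcases h Z Z.isClosed with hZ | hZ
    · exact Or.inr fun W _ => show (W : Set X) ⊆ Z from hZ ▸ Set.subset_univ _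
    · obtain ⟨p, hp⟩ := Z.isIrreducible.nonempty
      have hZp := Z.isIrreducible.eq_singleton_of_finite hZ hp
      refine Or.inl fun W hW => ?_
      obtain ⟨q, hq⟩ := W.isIrreducible.nonempty
      have hWp : (W : Set X) ⊆ {p} := hZp ▸ hW
      have hqp : q = p := hWp hq
      change (Z : Set X) ⊆ W
      rw [hZp, ← hqp]
      exact Set.singleton_subset_iff.2 hq
  · obtain ⟨p⟩ := (inferInstance : Nonempty X)
    refine Order.one_le_krullDim_iff.2 ⟨⟨{p}, isIrreducible_singleton, isClosed_singleton⟩,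
      ⟨Set.univ, huniv, isClosed_univ⟩, ?_⟩
    refine lt_of_le_of_ne (fun _ _ => Set.mem_univ _) fun hc => ?_
    have h1 : ({p} : Set X) = Set.univ := congrArg TopologicalSpace.IrreducibleCloseds.carrier hc
    exact Set.infinite_univ (h1 ▸ Set.finite_singleton p)

/-! ### The line as a one-dimensional irreducible variety -/

/-- The line `u 0 + u 1 = 1` in the affine plane. -/
def unitLine : Set (CAffine 2) := {u | u.coord 0 + u.coord 1 = 1}

theorem unitLine_infinite : unitLine.Infinite := by
  refine Set.infinite_of_injective_forall_mem (f := fun t : ℂ => CAffine.mk ![t, 1 - t]) ?_ ?_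
  · intro s t hst
    simpa using congrFun (congrArg CAffine.coord hst) 0
  · intro t
    simp [unitLine]

theorem unitLine_inter_closed (Z : Set (CAffine 2)) (hZ : IsClosed Z) :
    unitLine ⊆ Z ∨ (unitLine ∩ Z).Finite := by
  obtain ⟨P, rfl⟩ := (CAffine.isClosed_iff Z).1 hZ
  -- Restriction to the line, parametrized by the first coordinate; a nonzero restriction has
  -- finitely many roots.
  let q : MvPolynomial (Fin 2) ℂ → Polynomial ℂ :=
    MvPolynomial.aeval ![Polynomial.X, 1 - Polynomial.X]
  have hq : ∀ p, ∀ u ∈ unitLine, (q p).eval (u.coord 0) = MvPolynomial.eval u.coord p := by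
    intro p u hu
    have hu' : u.coord 1 = 1 - u.coord 0 := eq_sub_of_add_eq' hu
    induction p using MvPolynomial.induction_on with
    | C c => simp [q]
    | add p r hp hr => simpa [q] using congrArg₂ (· + ·) hp hr
    | mul_X p i hp =>
      have hi : ((![Polynomial.X, 1 - Polynomial.X] : Fin 2 → Polynomial ℂ) i).eval (u.coord 0)
          = u.coord i := by
        fin_cases i <;> simp [hu']
      simp only [q, map_mul, MvPolynomial.aeval_X, Polynomial.eval_mul, MvPolynomial.eval_X, hi]
      simp only [q] at hp
      rw [hp]
  by_cases h : ∀ p ∈ P, q p = 0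
  · left
    intro u hu p hp
    rw [← hq p u hu, h p hp, Polynomial.eval_zero]
  · push Not at h
    obtain ⟨p, hp, hp0⟩ := h
    right
    refine Set.Finite.of_finite_image (f := fun u => u.coord 0)
      ((q p).roots.toFinset.finite_toSet.subset ?_) ?_
    · rintro _ ⟨u, ⟨hu, huZ⟩, rfl⟩
      simp [hp0, hq p u hu, huZ p hp]
    · rintro u ⟨hu, -⟩ v ⟨hv, -⟩ huv
      have huv' : u.coord 0 = v.coord 0 := huv
      have hu' : u.coord 1 = 1 - u.coord 0 := eq_sub_of_add_eq' hu
      have hv' : v.coord 1 = 1 - v.coord 0 := eq_sub_of_add_eq' hv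
      ext i
      fin_cases i
      · exact huv'
      · simp [hu', hv', huv']

theorem zariskiDim_unitLine : zariskiDim unitLine = 1 := by
  have : Infinite unitLine := unitLine_infinite.to_subtype
  refine topologicalKrullDim_eq_one fun Z hZ => ?_
  obtain ⟨W, hW, rfl⟩ := isClosed_induced_iff.1 hZ
  rcases unitLine_inter_closed W hW with h | h
  · exact Or.inl (Set.eq_univ_of_forall fun x => h x.2)
  · right
    refine Set.Finite.of_finite_image (f := Subtype.val) (h.subset ?_)
      Subtype.val_injective.injOn
    rintro _ ⟨x, hx, rfl⟩
    exact ⟨x.2, hx⟩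

theorem polyIsomorphic_unitLine : PolyIsomorphic unitLine (Set.univ : Set (CAffine 1)) := by
  refine ⟨![MvPolynomial.X 0], ![MvPolynomial.X 0, 1 - MvPolynomial.X 0],
    fun _ _ => Set.mem_univ _, fun u _ => ?_, fun u hu => ?_, fun u _ => ?_⟩
  · simp [unitLine, polyMap]
  · have hu' : u.coord 1 = 1 - u.coord 0 := eq_sub_of_add_eq' hu
    ext i
    fin_cases i <;> simp [polyMap, hu']
  · ext i
    fin_cases i
    simp [polyMap]

/-! ### Two isolated vertices -/

theorem mem_uVariety_two_iff {Δ : FaceComplex 2} (h : Δ.IsIsolatedVertices)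
    (a : Fin 2 → Fin 2 → ℕ) (u : CAffine 2) :
    u ∈ uVariety Δ a ↔
      u.coord 0 + u.coord 1 ^ a 0 1 = 1 ∧ u.coord 1 + u.coord 0 ^ a 1 0 = 1 := by
  have h0 : (Finset.univ : Finset (Fin 2)).erase 0 = {1} := by decide
  have h1 : (Finset.univ : Finset (Fin 2)).erase 1 = {0} := by decide
  simp [mem_uVariety_iff h, Fin.forall_fin_two, h0, h1]

theorem uVariety_two_eq_unitLine {Δ : FaceComplex 2} (h : Δ.IsIsolatedVertices)
    {a : Fin 2 → Fin 2 → ℕ} (h01 : a 0 1 = 1) (h10 : a 1 0 = 1) : uVariety Δ a = unitLine := by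
  ext u
  rw [mem_uVariety_two_iff h, h01, h10, pow_one, pow_one, add_comm (u.coord 1), and_self]
  rfl

/-- The elimination identity `t + (1 - t ^ a) ^ b = 1` holds identically only if `a = b = 1`. -/
theorem exponents_eq_one_of_elimination {a b : ℕ}
    (h : ∀ t : ℂ, t + (1 - t ^ a) ^ b = 1) (ha : 0 < a) (hb : 0 < b) : a = 1 ∧ b = 1 := by
  have ha1 : a = 1 := by
    -- At `t = 2` the identity makes `1 - 2 ^ a` a unit of `ℤ`.
    have h2 : (1 - (2 : ℤ) ^ a) ^ b = -1 := by
      have := h 2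
      have h3 : (1 - (2 : ℂ) ^ a) ^ b = -1 := by linear_combination this
      exact_mod_cast h3
    have h3 : IsUnit (1 - (2 : ℤ) ^ a) :=
      (isUnit_pow_iff hb.ne').1 (h2 ▸ isUnit_one.neg)
    rcases Int.isUnit_iff.1 h3 with h4 | h4
    · have : (2 : ℤ) ^ a ≠ 0 := by positivity
      omega
    · have h5 : (2 : ℤ) ^ a = 2 ^ 1 := by omega
      exact Int.pow_right_injective (by norm_num) h5
  subst ha1
  refine ⟨rfl, ?_⟩
  -- With `a = 1` known, this is the identity at `t = -1`.
  have h2 : (2 : ℤ) ^ b = 2 ^ 1 := by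
    have h3 := h (-1)
    have h4 : (2 : ℂ) ^ b = 2 ^ 1 := by
      norm_num at h3 ⊢
      linear_combination h3
    exact_mod_cast h4
  exact Int.pow_right_injective (by norm_num) h2

theorem uVariety_two_finite {Δ : FaceComplex 2} (h : Δ.IsIsolatedVertices)
    {a : Fin 2 → Fin 2 → ℕ} (h01 : 0 < a 0 1) (h10 : 0 < a 1 0)
    (hne : ¬(a 0 1 = 1 ∧ a 1 0 = 1)) : (uVariety Δ a).Finite := by
  -- The result of eliminating the first coordinate: the second one is a root of `q` and determines
  -- the first.
  let q : Polynomial ℂ := Polynomial.X + (1 - Polynomial.X ^ a 0 1) ^ a 1 0 - 1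
  have hq : q ≠ 0 := by
    intro hq
    refine hne (exponents_eq_one_of_elimination (fun t => ?_) h01 h10)
    have := congrArg (Polynomial.eval t) hq
    simpa [q, sub_eq_zero] using this
  refine Set.Finite.of_finite_image (f := fun u => u.coord 1)
    (q.roots.toFinset.finite_toSet.subset ?_) ?_
  · rintro _ ⟨u, hu, rfl⟩
    obtain ⟨h0, h1⟩ := (mem_uVariety_two_iff h a u).1 hu
    rw [← eq_sub_iff_add_eq] at h0
    rw [h0] at h1
    simp [hq, q, h1]
  · intro u hu v hv huv
    have huv' : u.coord 1 = v.coord 1 := huv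
    have hu0 := eq_sub_iff_add_eq.2 ((mem_uVariety_two_iff h a u).1 hu).1
    have hv0 := eq_sub_iff_add_eq.2 ((mem_uVariety_two_iff h a v).1 hv).1
    ext i
    fin_cases i
    · simp [hu0, hv0, huv']
    · exact huv'

theorem IsBinaryGeometryWith.exponents_eq_one {Δ : FaceComplex 2} {a : Fin 2 → Fin 2 → ℕ}
    {V : Set (CAffine 2)} (hV : IsBinaryGeometryWith Δ a V) (h : Δ.IsIsolatedVertices) :
    a 0 1 = 1 ∧ a 1 0 = 1 := by
  have h01 := hV.exponent_pos 0 1 (by simp [h.compatible_iff])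
  have h10 := hV.exponent_pos 1 0 (by simp [h.compatible_iff])
  by_contra hne
  have hirr := hV.irreducible ∅ ((h ∅).2 (by simp))
  have hemp : coordSubspace (∅ : Finset (Fin 2)) = Set.univ := by simp [coordSubspace]
  rw [hemp, Set.inter_univ, hV.cut_out] at hirr
  have hp : CAffine.mk ![0, 1] ∈ uVariety Δ a := by
    rw [mem_uVariety_two_iff h]
    simp [h10.ne']
  have hq : CAffine.mk ![1, 0] ∈ uVariety Δ a := by
    rw [mem_uVariety_two_iff h]
    simp [h01.ne']
  rw [hirr.eq_singleton_of_finite (uVariety_two_finite h h01 h10 hne) hp] at hq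
  simpa using congrFun (congrArg CAffine.coord (Set.mem_singleton_iff.1 hq)) 0

theorem unitLine_inter_coordSubspace_singleton (i : Fin 2) :
    unitLine ∩ coordSubspace {i} = {CAffine.mk fun j => if j = i then 0 else 1} := by
  ext u
  simp only [unitLine, coordSubspace, Set.mem_inter_iff, Set.mem_ofPred_eq,
    Finset.mem_singleton, forall_eq, Set.mem_singleton_iff, CAffine.ext_iff, funext_iff,
    Fin.forall_fin_two]
  fin_cases i
  · simp only [Fin.zero_eta, if_true, one_ne_zero, if_false]
    constructor
    · rintro ⟨h, h0⟩
      exact ⟨h0, by simpa [h0] using h⟩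
    · rintro ⟨h0, h1⟩
      exact ⟨by simp [h0, h1], h0⟩
  · simp only [Fin.mk_one, if_true, zero_ne_one, if_false]
    constructor
    · rintro ⟨h, h0⟩
      exact ⟨by simpa [h0] using h, h0⟩
    · rintro ⟨h0, h1⟩
      exact ⟨by simp [h0, h1], h1⟩

theorem isBinaryGeometryWith_two {Δ : FaceComplex 2} {a : Fin 2 → Fin 2 → ℕ}
    (h : Δ.IsIsolatedVertices) (h01 : a 0 1 = 1) (h10 : a 1 0 = 1) :
    IsBinaryGeometryWith Δ a (uVariety Δ a) := by
  have hline := uVariety_two_eq_unitLine h h01 h10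
  have hemp : coordSubspace (∅ : Finset (Fin 2)) = Set.univ := by simp [coordSubspace]
  have hcases : ∀ S ∈ Δ.faces, S = ∅ ∨ ∃ i, S = {i} := by
    intro S hS
    have := (h S).1 hS
    rcases Nat.le_one_iff_eq_zero_or_eq_one.1 this with h | h
    · exact Or.inl (Finset.card_eq_zero.1 h)
    · exact Or.inr (Finset.card_eq_one.1 h)
  have hirr : ∀ S ∈ Δ.faces, IsIrreducible (unitLine ∩ coordSubspace S) := by
    intro S hS
    rcases hcases S hS with rfl | ⟨i, rfl⟩
    · rw [hemp, Set.inter_univ]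
      exact isIrreducible_of_infinite unitLine_infinite unitLine_inter_closed
    · rw [unitLine_inter_coordSubspace_singleton]
      exact isIrreducible_singleton
  constructor
  · exact h.isFlag
  · intro i j hij
    rw [h.compatible_iff] at hij
    fin_cases i <;> fin_cases j <;> simp_all
  · rfl
  · exact ⟨1, by rw [hline, zariskiDim_unitLine]; rfl, by rw [h.dim_eq_zero 0]; rfl⟩
  · intro S
    rw [hline]
    refine ⟨fun ⟨u, hu, hS⟩ => ?_, fun hS => (hirr S hS).nonempty⟩
    rw [h]
    by_contra hc
    have hall : ∀ i, i ∈ S := by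
      have h2 : S = Finset.univ := by
        rw [← Finset.card_eq_iff_eq_univ, Fintype.card_fin]
        have := Finset.card_le_univ S
        rw [Fintype.card_fin] at this
        omega
      simp [h2]
    have hu' : u.coord 0 + u.coord 1 = 1 := hu
    rw [hS 0 (hall 0), hS 1 (hall 1), add_zero] at hu'
    exact zero_ne_one hu'
  · exact hline ▸ hirr
  · intro S hS
    rw [hline]
    rcases hcases S hS with rfl | ⟨i, rfl⟩
    · simp [hemp]
    · rw [unitLine_inter_coordSubspace_singleton, zariskiDim_singleton, zariskiDim_unitLine]
      simp

/-! ### Classification of one-dimensional binary geometries -/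

theorem IsBinaryGeometry.of_zariskiDim_eq_one {n : ℕ} {Δ : FaceComplex n} {V : Set (CAffine n)}
    (hV : IsBinaryGeometry Δ V) (hdim : zariskiDim V = 1) :
    n = 2 ∧ Δ.IsIsolatedVertices ∧ PolyIsomorphic V (Set.univ : Set (CAffine 1)) := by
  obtain ⟨a, hV⟩ := hV
  obtain ⟨d, hd, hdΔ⟩ := hV.dim_eq
  have hd1 : d = 1 := by
    rw [hdim] at hd
    exact_mod_cast hd.symm
  have hΔ : Δ.IsIsolatedVertices := hV.flag.isIsolatedVertices (by rw [hd1] at hdΔ; simpa using hdΔ)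
  have hirr : IsIrreducible V := by
    have := hV.irreducible ∅ ((hΔ ∅).2 (by simp))
    simpa [coordSubspace] using this
  have hns : ∀ p, V ≠ {p} := by
    rintro p rfl
    rw [zariskiDim_singleton] at hdim
    exact zero_ne_one hdim
  have hpos : ∀ i j, i ≠ j → 0 < a i j := fun i j hij =>
    hV.exponent_pos i j (by rwa [hΔ.compatible_iff])
  obtain hn | rfl | hn : n < 2 ∨ n = 2 ∨ 3 ≤ n := by omega
  -- With at most one vertex the product is empty, so only the origin solves the equations.
  · exfalso
    obtain ⟨p, hp⟩ := hirr.nonempty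
    refine hns p (Set.Subset.antisymm (fun q hq => ?_) (Set.singleton_subset_iff.2 hp))
    have hsub : Subsingleton (Fin n) := Fin.subsingleton_iff_le_one.2 (by omega)
    have hzero : ∀ u ∈ V, ∀ i, u.coord i = 0 := by
      intro u hu i
      rw [hV.cut_out, mem_uVariety_iff hΔ] at hu
      have he : (Finset.univ : Finset (Fin n)).erase i = ∅ :=
        Finset.eq_empty_of_forall_notMem fun j hj =>
          Finset.ne_of_mem_erase hj (Subsingleton.elim j i)
      simpa [he] using hu i
    ext i
    rw [hzero q hq i, hzero p hp i]
  · obtain ⟨h01, h10⟩ := hV.exponents_eq_one hΔ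
    refine ⟨rfl, hΔ, ?_⟩
    rw [hV.cut_out, uVariety_two_eq_unitLine hΔ h01 h10]
    exact polyIsomorphic_unitLine
  · exfalso
    obtain ⟨O, hO, hp⟩ := uVariety_inter_open_eq_singleton hn hΔ hpos ⟨0, by omega⟩
    rw [← hV.cut_out] at hp
    exact hns _ (hirr.subset_singleton_of_inter_open hO hp)

theorem mainTheorem1 :
    -- a one-dimensional binary geometry forces two isolated vertices and is an affine line
    (∀ (n : ℕ) (Δ : FaceComplex n) (V : Set (CAffine n)),
      IsBinaryGeometry Δ V → zariskiDim V = 1 →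
        n = 2 ∧ Δ.IsIsolatedVertices ∧ PolyIsomorphic V (Set.univ : Set (CAffine 1))) ∧
    -- for two isolated vertices, exactly the exponents `1, 1` give a binary geometry
    (∀ (Δ : FaceComplex 2) (a : Fin 2 → Fin 2 → ℕ), Δ.IsIsolatedVertices →
      (∀ i j, i ≠ j → 0 < a i j) →
        (IsBinaryGeometryWith Δ a (uVariety Δ a) ↔ a 0 1 = 1 ∧ a 1 0 = 1)) ∧
    -- for three or more isolated vertices, `(0, 1, …, 1)` and its permutations are isolated points
    (∀ (n : ℕ) (Δ : FaceComplex n) (a : Fin n → Fin n → ℕ), 3 ≤ n → Δ.IsIsolatedVertices →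
      (∀ i j, i ≠ j → 0 < a i j) → ∀ i : Fin n,
        ∃ O : Set (CAffine n), IsOpen O ∧
          uVariety Δ a ∩ O = {CAffine.mk fun j => if j = i then 0 else 1}) := by
  refine ⟨fun n Δ V hV hdim => hV.of_zariskiDim_eq_one hdim, fun Δ a hΔ _ => ?_,
    fun n Δ a hn hΔ ha i => uVariety_inter_open_eq_singleton hn hΔ ha i⟩
  exact ⟨fun h => h.exponents_eq_one hΔ, fun h => isBinaryGeometryWith_two hΔ h.1 h.2⟩
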